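/- Identify $\mathbb{S}^1$ with the unit circle and write $e(t) = (\cos t, \sin t)$. Let $F : \mathbb{R}^2 \to \mathbb{R}^2$ be a $C^\infty$ map with critical set $C = \{p : \det DF(p) = 0\}$, and suppose that $F$ is excellent: every $p \in C$ is a fold or a cusp, i.e. there are local $C^\infty$ diffeomorphisms $\Psi$ near $p$ with $\Psi(p) = 0$, and $\Phi$ near $0$, such that near $p$ one has $F = \Phi \circ \tilde F \circ \Psi$ with $\tilde F(x,y) = (x, y^2)$ (fold) or $\tilde F(x,y) = (x, y^3 - xy)$ (cusp). For a closed curve $c : \mathbb{S}^1 \to \mathbb{R}^2$ avoiding a point $q$, the winding number $W(c,q) \in \mathbb{Z}$ is $\frac{1}{2\pi}(\theta(2\pi) - \theta(0))$, where $\theta : [0,2\pi] \to \mathbb{R}$ is continuous with $c(e(t)) - q = |c(e(t)) - q|\,(\cos\theta(t), \sin\theta(t))$ for all $t \in [0,2\pi]$. For $1 \le r \le \infty$, a regular closed curve of class $C^r$ is a map $c : \mathbb{S}^1 \to \mathbb{R}^2$ such that $c \circ e$ is $C^r$ and $(c\circ e)'(t) \neq 0$ for all $t$; its rotation number is $W(c',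 0)$, where $c'(e(t)) = (c \circ e)'(t)$. Let $1 \le r \le \infty$ and let $\gamma : \mathbb{S}^1 \to \mathbb{R}^2$ be an injective regular closed curve of class $C^r$ whose image is the boundary of a closed topological disk $\Delta \subset \mathbb{R}^2$ (a set homeomorphic to the closed unit disk). Suppose that $\gamma$ is positively oriented, i.e. $W(\gamma, q) = 1$ for every $q$ in the interior of $\Delta$, and that $\Delta \cap C = \emptyset$. Then $F \circ \gamma$ is a regular closed curve of class $C^r$, and its rotation number is $\operatorname{sgn} \det DF(p)$ for every $p \in \Delta$. -/

import Mathlib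

open Set Filter Topology
open scoped ContDiff Manifold

/-- The Euclidean plane. -/
abbrev Plane : Type := EuclideanSpace ℝ (Fin 2)

/-- The critical set of `F`: the points where the Jacobian is not invertible. -/
def criticalSet (F : Plane → Plane) : Set Plane :=
  {p | (fderiv ℝ F p).det = 0}

/-- Near `p`, the map `F` takes the form `G` after smooth local changes of variable near `p`
(sending `p` to the origin) and near `F p`. It is used for maps `G` fixing the origin, so that the
germ identity forces `Φ 0 = F p`. -/
def HasNormalFormAt (F G : Plane → Plane) (p : Plane) : Prop :=
  ∃ Φ Ψ : Plane → Plane,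
    IsLocalDiffeomorphAt 𝓘(ℝ, Plane) 𝓘(ℝ, Plane) ∞ Ψ p ∧ Ψ p = 0 ∧
    IsLocalDiffeomorphAt 𝓘(ℝ, Plane) 𝓘(ℝ, Plane) ∞ Φ 0 ∧
    F =ᶠ[𝓝 p] Φ ∘ G ∘ Ψ

/-- The normal form `(x, y) ↦ (x, y²)` of a fold. -/
noncomputable def foldForm (v : Plane) : Plane := !₂[v 0, v 1 ^ 2]

/-- The normal form `(x, y) ↦ (x, y³ - x y)` of a cusp. -/
noncomputable def cuspForm (v : Plane) : Plane := !₂[v 0, v 1 ^ 3 - v 0 * v 1]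

/-- `p` is a fold point of `F`. -/
def IsFoldPoint (F : Plane → Plane) (p : Plane) : Prop :=
  p ∈ criticalSet F ∧ HasNormalFormAt F foldForm p

/-- `p` is a cusp point of `F`. -/
def IsCuspPoint (F : Plane → Plane) (p : Plane) : Prop :=
  p ∈ criticalSet F ∧ HasNormalFormAt F cuspForm p

/-- A smooth map of the plane is excellent if all its critical points are folds or cusps. -/
def IsExcellent (F : Plane → Plane) : Prop :=
  ContDiff ℝ ∞ F ∧ ∀ p ∈ criticalSet F, IsFoldPoint F p ∨ IsCuspPoint F p

/-- The composition `c ∘ e` of a closed curve `c` with `e t = (cos t, sin t)`. -/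
noncomputable def curveLift (c : Circle → Plane) (t : ℝ) : Plane := c (Circle.exp t)

/-- `c` is a parametrized regular closed curve of class `C^r`: `c ∘ e` is `C^r` and its
derivative never vanishes. -/
def IsRegularClosedCurve (r : ℕ∞) (c : Circle → Plane) : Prop :=
  ContDiff ℝ r (curveLift c) ∧ ∀ t, deriv (curveLift c) t ≠ 0

/-- The velocity `c'` of a closed curve, as a map on the circle: `c' (e t) = (c ∘ e)' t`
(see `velocity_exp`). -/
noncomputable def velocity (c : Circle → Plane) (z : Circle) : Plane :=
  deriv (curveLift c) (Complex.arg z)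

theorem velocity_exp (c : Circle → Plane) (t : ℝ) :
    velocity c (Circle.exp t) = deriv (curveLift c) t := by
  have hper : Function.Periodic (curveLift c) (2 * Real.pi) := fun s => by
    simp [curveLift, Circle.periodic_exp s]
  have hd : Function.Periodic (deriv (curveLift c)) (2 * Real.pi) := fun s => by
    rw [← deriv_comp_add_const]
    congr 1
    exact funext hper
  obtain ⟨m, hm⟩ := Circle.exp_eq_exp.1 (Circle.exp_arg (Circle.exp t))
  rw [velocity, hm]
  exact hd.int_mul m t

/-- `θ` is a continuous argument function on `[a, b]` of the path `φ` with respect to the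
point `p`. -/
def IsArgumentFunction (φ : ℝ → Plane) (p : Plane) (a b : ℝ) (θ : ℝ → ℝ) : Prop :=
  ContinuousOn θ (Icc a b) ∧
    ∀ t ∈ Icc a b, φ t - p = ‖φ t - p‖ • (!₂[Real.cos (θ t), Real.sin (θ t)] : Plane)

/-- The closed curve `c` avoids `p` and has winding number `n` around `p`: the angle swept by
`c ∘ e` on `[0, 2π]` with respect to `p` is `2πn`. -/
def HasWindingNumber (c : Circle → Plane) (p : Plane) (n : ℤ) : Prop :=
  (∀ z, c z ≠ p) ∧
    ∃ θ : ℝ → ℝ, IsArgumentFunction (curveLift c) p 0 (2 * Real.pi) θ ∧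
      θ (2 * Real.pi) - θ 0 = 2 * Real.pi * n

/-- The winding number is unique, i.e. it does not depend on the argument function. -/
theorem HasWindingNumber.unique {c : Circle → Plane} {p : Plane} {m n : ℤ}
    (hm : HasWindingNumber c p m) (hn : HasWindingNumber c p n) : m = n := by
  obtain ⟨hp, θ, ⟨hθc, hθ⟩, hθm⟩ := hm
  obtain ⟨-, η, ⟨hηc, hη⟩, hηn⟩ := hn
  have hpi := Real.pi_pos
  have key : ∀ t ∈ Icc 0 (2 * Real.pi), ∃ k : ℤ, (θ t - η t) / (2 * Real.pi) = k := by
    intro t ht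
    have h0 : ‖curveLift c t - p‖ ≠ 0 := norm_ne_zero_iff.2 (sub_ne_zero.2 (hp _))
    have h := smul_right_injective Plane h0 ((hθ t ht).symm.trans (hη t ht))
    have h1 : Real.cos (θ t) = Real.cos (η t) := by simpa using congrArg (fun v : Plane => v 0) h
    have h2 : Real.sin (θ t) = Real.sin (η t) := by simpa using congrArg (fun v : Plane => v 1) h
    have h3 : Real.cos (θ t - η t) = 1 := by
      rw [Real.cos_sub, h1, h2]
      nlinarith [Real.sin_sq_add_cos_sq (η t)]
    obtain ⟨k, hk⟩ := (Real.cos_eq_one_iff _).1 h3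
    exact ⟨k, by rw [← hk]; field_simp⟩
  have hconst := (isPreconnected_Icc (a := (0 : ℝ)) (b := 2 * Real.pi)).constant_of_mapsTo
    (T := range ((↑) : ℤ → ℝ))
    ⟨Int.isClosedEmbedding_coe_real.isEmbedding.toHomeomorph.symm.isEmbedding.discreteTopology⟩
    (f := fun t => (θ t - η t) / (2 * Real.pi))
    ((hθc.sub hηc).div_const _) (fun t ht => by obtain ⟨k, hk⟩ := key t ht; exact ⟨k, hk.symm⟩)
    (right_mem_Icc.2 (by positivity)) (left_mem_Icc.2 (by positivity))
  have h4 : θ (2 * Real.pi) - η (2 * Real.pi) = θ 0 - η 0 := by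
    have := congrArg (· * (2 * Real.pi)) hconst
    simpa [hpi.ne'] using this
  have h5 : 2 * Real.pi * (m : ℝ) = 2 * Real.pi * n := by linarith
  exact_mod_cast mul_left_cancel₀ (by positivity) h5

/-- The rotation number of `c` is the winding number of `c'` around the origin. -/
def HasRotationNumber (c : Circle → Plane) (n : ℤ) : Prop :=
  HasWindingNumber (velocity c) 0 n

/-- `Δ` is a closed topological disk, i.e. homeomorphic to the closed unit disk. -/
def IsClosedTopologicalDisk (Δ : Set Plane) : Prop :=
  Nonempty (Δ ≃ₜ Metric.closedBall (0 : Plane) 1)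

/-- The closed curve `c`, with image the boundary of `Δ`, is positively oriented: it winds once
counterclockwise around every interior point of `Δ`. -/
def IsPositivelyOriented (c : Circle → Plane) (Δ : Set Plane) : Prop :=
  ∀ p ∈ interior Δ, HasWindingNumber c p 1

/-! The velocity of `F ∘ c` at `t` is `DF (c t) (c' t)`. Since `Δ` is contractible and `DF` is
invertible on it, the base point of `DF` can be moved inside `Δ` to any chosen `p` without creating
a zero. So the rotation number of `F ∘ c` is the winding number of `DF p (c' t)`, which is `sgn det
DF p` times the rotation number of `c` (`Winds.linearMap`).

It remains to see that `c` has rotation number one. By Hopf's argument, applied at a lowest point of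
the curve, the velocity winds `n = ±1` times around the origin (`winds_velocity_of_im_nonneg`), and
the curve winds equally often around a point `q` slightly above the lowest one
(`winds_sub_of_im_nonneg`). As `n ≠ 0`, the point `q` cannot lie outside `Δ`, where contracting `Δ`
would unwind the curve. So `q` is interior, and positive orientation gives `n = 1`. The Jordan curve
theorem is not needed.

Everything is computed in `ℂ` with continuous logarithms; the basic tool is that two loops whose
ratio avoids `(-∞, 0]` wind equally often (`Winds.of_div_mem_slitPlane`). -/

/-- The loop `f : [0, 2π] → ℂ` avoids the origin and winds `n` times around it, expressed through a
continuous logarithm. -/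
def Winds (f : ℝ → ℂ) (n : ℤ) : Prop :=
  ∃ L : ℝ → ℂ, ContinuousOn L (Icc 0 (2 * Real.pi)) ∧
    (∀ t ∈ Icc 0 (2 * Real.pi), Complex.exp (L t) = f t) ∧
    L (2 * Real.pi) - L 0 = n * (2 * Real.pi * Complex.I)

/-! ### Winding numbers of loops in the punctured complex plane. -/

namespace Winds

open Complex (I slitPlane)

theorem zero_mem : (0 : ℝ) ∈ Icc 0 (2 * Real.pi) := left_mem_Icc.2 (by positivity)

theorem two_pi_mem : 2 * Real.pi ∈ Icc 0 (2 * Real.pi) := right_mem_Icc.2 (by positivity)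

theorem const {z : ℂ} (hz : z ≠ 0) : Winds (fun _ => z) 0 :=
  ⟨fun _ => Complex.log z, continuousOn_const, fun _ _ => Complex.exp_log hz, by simp⟩

theorem exp_mul_I : Winds (fun t => Complex.exp (t * I)) 1 :=
  ⟨fun t => t * I, by fun_prop, fun _ _ => rfl, by push_cast; ring⟩

variable {f g : ℝ → ℂ} {m n : ℤ}

theorem continuousOn (h : Winds f n) : ContinuousOn f (Icc 0 (2 * Real.pi)) := by
  obtain ⟨L, hL, hf, -⟩ := h
  exact (Complex.continuous_exp.comp_continuousOn hL).congr fun t ht => (hf t ht).symm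

theorem ne_zero (h : Winds f n) {t : ℝ} (ht : t ∈ Icc 0 (2 * Real.pi)) : f t ≠ 0 := by
  obtain ⟨L, -, hf, -⟩ := h
  exact hf t ht ▸ Complex.exp_ne_zero _

theorem ne_zero_of_periodic (h : Winds f n) (hper : Function.Periodic f (2 * Real.pi)) (t : ℝ) :
    f t ≠ 0 := by
  obtain ⟨y, hy, hfy⟩ := hper.exists_mem_Ico₀ Real.two_pi_pos t
  exact hfy ▸ h.ne_zero (Ico_subset_Icc_self hy)

theorem closed (h : Winds f n) : f 0 = f (2 * Real.pi) := by
  obtain ⟨L, -, hf, hn⟩ := h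
  rw [← hf _ zero_mem, ← hf _ two_pi_mem, eq_add_of_sub_eq hn, Complex.exp_add,
    Complex.exp_int_mul_two_pi_mul_I, one_mul]

theorem congr (h : Winds f n) (hfg : ∀ t ∈ Icc 0 (2 * Real.pi), g t = f t) : Winds g n := by
  obtain ⟨L, hL, hf, hn⟩ := h
  exact ⟨L, hL, fun t ht => (hf t ht).trans (hfg t ht).symm, hn⟩

theorem mul (hf : Winds f m) (hg : Winds g n) : Winds (fun t => f t * g t) (m + n) := by
  obtain ⟨L, hL, hLf, hm⟩ := hf
  obtain ⟨M, hM, hMg, hn⟩ := hg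
  refine ⟨fun t => L t + M t, hL.add hM, fun t ht => ?_, ?_⟩
  · rw [Complex.exp_add, hLf t ht, hMg t ht]
  · push_cast
    linear_combination hm + hn

theorem const_mul {z : ℂ} (hz : z ≠ 0) (hf : Winds f n) : Winds (fun t => z * f t) n := by
  simpa using (Winds.const hz).mul hf

theorem conj (hf : Winds f n) : Winds (fun t => (starRingEnd ℂ) (f t)) (-n) := by
  obtain ⟨L, hL, hLf, hn⟩ := hf
  refine ⟨fun t => (starRingEnd ℂ) (L t), Complex.continuous_conj.comp_continuousOn hL,
    fun t ht => ?_, ?_⟩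
  · rw [Complex.exp_conj, hLf t ht]
  · have := congrArg (starRingEnd ℂ) hn
    simp only [map_sub, map_mul, Complex.conj_I, Complex.conj_ofReal, map_intCast, map_ofNat] at this
    rw [this]
    push_cast
    ring

/-- Two loops whose ratio is never a negative real number wind equally often. -/
theorem of_div_mem_slitPlane (hg : Winds g n) (hf : ContinuousOn f (Icc 0 (2 * Real.pi)))
    (hclosed : f 0 = f (2 * Real.pi))
    (h : ∀ t ∈ Icc 0 (2 * Real.pi), f t / g t ∈ slitPlane) : Winds f n := by
  have hgc := hg.closed
  have hg0 := fun t (ht : t ∈ Icc 0 (2 * Real.pi)) => hg.ne_zero ht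
  have hcont := (hf.div hg.continuousOn hg0).clog h
  -- The principal logarithm of the ratio is continuous on the slit plane and takes equal values at
  -- the two ends.
  have hw : Winds (fun t => f t / g t) 0 :=
    ⟨fun t => Complex.log (f t / g t), hcont,
      fun t ht => Complex.exp_log (Complex.slitPlane_ne_zero (h t ht)), by simp [hgc, hclosed]⟩
  simpa using (hw.mul hg).congr (g := f) fun t ht => (div_mul_cancel₀ _ (hg0 t ht)).symm

/-- Homotopy invariance of the winding number. -/
theorem homotopy {H : ℝ → ℝ → ℂ}
    (hH : ContinuousOn (Function.uncurry H) (Icc 0 1 ×ˢ Icc 0 (2 * Real.pi)))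
    (hne : ∀ s ∈ Icc (0 : ℝ) 1, ∀ t ∈ Icc 0 (2 * Real.pi), H s t ≠ 0)
    (hclosed : ∀ s ∈ Icc (0 : ℝ) 1, H s 0 = H s (2 * Real.pi))
    (h : Winds (H 0) n) : Winds (H 1) n := by
  have hK : IsCompact (Icc (0 : ℝ) 1 ×ˢ Icc 0 (2 * Real.pi)) := isCompact_Icc.prod isCompact_Icc
  -- Subdivide `[0, 1]` so finely that consecutive loops differ by less than the minimum modulus of
  -- `H`. Their ratio then stays within distance less than one of `1`, hence in the slit plane.
  obtain ⟨x₀, hx₀, hmin⟩ := hK.exists_isMinOn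
    ⟨(0, 0), ⟨by simp, zero_mem⟩⟩ hH.norm
  have hm : 0 < ‖Function.uncurry H x₀‖ := norm_pos_iff.2 (hne _ hx₀.1 _ hx₀.2)
  obtain ⟨δ, hδ, hunif⟩ := Metric.uniformContinuousOn_iff.1
    (hK.uniformContinuousOn_of_continuous hH) _ hm
  obtain ⟨N, hN⟩ := exists_nat_one_div_lt hδ
  have hN' : (0 : ℝ) < N + 1 := by positivity
  have hmem : ∀ k : ℕ, k ≤ N + 1 → (k / (N + 1) : ℝ) ∈ Icc (0 : ℝ) 1 := fun k hk =>
    ⟨by positivity, (div_le_one hN').2 (by exact_mod_cast hk)⟩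
  have key : ∀ k : ℕ, k ≤ N + 1 → Winds (H (k / (N + 1))) n := by
    intro k
    induction k with
    | zero => intro _; simpa using h
    | succ k ih =>
      intro hk
      have hs := hmem k (by omega)
      have hs' := hmem (k + 1) hk
      refine (ih (by omega)).of_div_mem_slitPlane ?_ (hclosed _ hs') fun t ht => ?_
      · exact hH.comp (f := fun t => (((k + 1 : ℕ) / (N + 1) : ℝ), t)) (by fun_prop)
          fun t ht => ⟨hs', ht⟩
      · have h0 := hne _ hs t ht
        have hd := hunif (_, t) ⟨hs', ht⟩ (_, t) ⟨hs, ht⟩ (by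
          rw [Prod.dist_eq, dist_self, max_eq_left dist_nonneg, Real.dist_eq, ← sub_div]
          push_cast
          rwa [add_sub_cancel_left, abs_of_pos (by positivity)])
        have hlt : ‖(H ((k + 1 : ℕ) / (N + 1)) t - H (k / (N + 1)) t) / H (k / (N + 1)) t‖ < 1 := by
          rw [norm_div, div_lt_one (norm_pos_iff.2 h0)]
          rw [dist_eq_norm] at hd
          exact hd.trans_le (hmin (show ((k / (N + 1) : ℝ), t) ∈ _ from ⟨hs, ht⟩))
        have := Complex.mem_slitPlane_of_norm_lt_one hlt
        rwa [sub_div, div_self h0, add_sub_cancel] at this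
  have := key (N + 1) le_rfl
  rwa [Nat.cast_add, Nat.cast_one, div_self hN'.ne'] at this

/-- The winding number of a periodic function does not depend on the base point. -/
theorem of_shift {a : ℝ} (hf : Continuous f) (hper : Function.Periodic f (2 * Real.pi))
    (h : Winds (fun t => f (a + t)) n) : Winds f n := by
  have hne : ∀ t, f t ≠ 0 := fun t => by
    have hper' : Function.Periodic (fun t => f (a + t)) (2 * Real.pi) := fun t => by
      simp only [← add_assoc, hper (a + t)]
    simpa using h.ne_zero_of_periodic hper' (t - a)
  have := homotopy (H := fun s t => f ((1 - s) * a + t)) (n := n) (by fun_prop)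
    (fun s _ t _ => hne _) (fun s _ => by simpa using (hper ((1 - s) * a)).symm) (by simpa using h)
  simpa using this

/-- An injective real-linear map multiplies winding numbers by the sign of its determinant. -/
theorem linearMap (A : ℂ →ₗ[ℝ] ℂ) (hA : LinearMap.det A ≠ 0) (hf : Winds f n) :
    Winds (fun t => A (f t)) ((SignType.sign (LinearMap.det A) : SignType) * n) := by
  -- Writing `A z = α z + β z̄` gives `det A = |α|² - |β|²`. The sign of the determinant tells which
  -- term dominates, and `A ∘ f` winds like that term.
  set α : ℂ := (A 1 - I * A I) / 2 with hα
  set β : ℂ := (A 1 + I * A I) / 2 with hβ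
  have hAz : ∀ z, A z = α * z + β * (starRingEnd ℂ) z := fun z => by
    have h1 : A z = z.re * A 1 + z.im * A I := by
      conv_lhs => rw [← Complex.re_add_im z]
      rw [map_add, show (z.re : ℂ) = z.re • (1 : ℂ) by simp,
        show (z.im : ℂ) * I = z.im • I by simp, map_smul, map_smul]
      simp
    have h2 : (starRingEnd ℂ) z = z.re - z.im * I := by
      apply Complex.ext <;> simp
    rw [h1, h2, hα, hβ]
    linear_combination (A 1 - I * A I) / 2 * Complex.re_add_im z + z.im * A I * Complex.I_mul_I
  have hdet : LinearMap.det A = ‖α‖ ^ 2 - ‖β‖ ^ 2 := by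
    rw [← LinearMap.det_toMatrix Complex.basisOneI, Matrix.det_fin_two]
    rw [← Complex.normSq_eq_norm_sq, ← Complex.normSq_eq_norm_sq, hα, hβ, Complex.normSq_div,
      Complex.normSq_div]
    simp [Complex.normSq_apply, LinearMap.toMatrix_apply]
    ring
  have hcont : ContinuousOn (fun t => A (f t)) (Icc 0 (2 * Real.pi)) :=
    (LinearMap.continuous_of_finiteDimensional A).comp_continuousOn hf.continuousOn
  have hclosed : A (f 0) = A (f (2 * Real.pi)) := by rw [hf.closed]
  rcases lt_or_gt_of_ne hA with hneg | hpos
  · have hlt : ‖α‖ < ‖β‖ := by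
      rw [hdet, sub_neg] at hneg
      exact lt_of_pow_lt_pow_left₀ 2 (norm_nonneg _) hneg
    have hβ0 : β ≠ 0 := norm_pos_iff.1 ((norm_nonneg _).trans_lt hlt)
    rw [sign_neg hneg]
    simp only [SignType.coe_neg_one, neg_one_mul]
    refine (hf.conj.const_mul hβ0).of_div_mem_slitPlane hcont hclosed fun t ht => ?_
    have h0 : (starRingEnd ℂ) (f t) ≠ 0 := hf.conj.ne_zero ht
    have : ‖α * f t / (β * (starRingEnd ℂ) (f t))‖ < 1 := by
      rw [norm_div, norm_mul, norm_mul, RCLike.norm_conj,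
        mul_div_mul_right _ _ (norm_ne_zero_iff.2 (hf.ne_zero ht)),
        div_lt_one (norm_pos_iff.2 hβ0)]
      exact hlt
    rw [hAz, add_div, div_self (mul_ne_zero hβ0 h0), add_comm]
    exact Complex.mem_slitPlane_of_norm_lt_one this
  · have hlt : ‖β‖ < ‖α‖ := by
      rw [hdet, sub_pos] at hpos
      exact lt_of_pow_lt_pow_left₀ 2 (norm_nonneg _) hpos
    have hα0 : α ≠ 0 := norm_pos_iff.1 ((norm_nonneg _).trans_lt hlt)
    rw [sign_pos hpos]
    simp only [SignType.coe_one, one_mul]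
    refine (hf.const_mul hα0).of_div_mem_slitPlane hcont hclosed fun t ht => ?_
    have h0 := hf.ne_zero ht
    have : ‖β * (starRingEnd ℂ) (f t) / (α * f t)‖ < 1 := by
      rw [norm_div, norm_mul, norm_mul, RCLike.norm_conj,
        mul_div_mul_right _ _ (norm_ne_zero_iff.2 h0), div_lt_one (norm_pos_iff.2 hα0)]
      exact hlt
    rw [hAz, add_div, div_self (mul_ne_zero hα0 h0)]
    exact Complex.mem_slitPlane_of_norm_lt_one this

end Winds

/-- The arguments lie in `[0, π]` and `(0, π)`, so their difference lies strictly between `-π` and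
`π`. Only one of the two inequalities has to be strict, which allows chords lying on the real axis.
-/
theorem Complex.div_mem_slitPlane_of_im {z w : ℂ} (hz : z ≠ 0) (hzi : 0 ≤ z.im) (hw : 0 < w.im) :
    z / w ∈ Complex.slitPlane := by
  by_contra h
  obtain ⟨x, hx, hxz⟩ : ∃ x : ℝ, x ≤ 0 ∧ z / w = x := by
    rw [Complex.mem_slitPlane_iff, not_or, not_lt, not_not] at h
    exact ⟨(z / w).re, h.1, Complex.ext rfl (by simpa using h.2)⟩
  have hw0 : w ≠ 0 := fun h => by simp [h] at hw
  rw [div_eq_iff hw0] at hxz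
  have him : z.im = x * w.im := by rw [hxz]; simp
  have hx0 : x = 0 := by nlinarith
  exact hz (by rw [hxz, hx0]; simp)

theorem Complex.div_mem_slitPlane_of_re {z w : ℂ} (hz : 0 < z.re) (hw : 0 < w.re) :
    z / w ∈ Complex.slitPlane := by
  have hz0 : z ≠ 0 := fun h => by simp [h] at hz
  rw [← mul_div_mul_left z w Complex.I_ne_zero]
  exact div_mem_slitPlane_of_im (mul_ne_zero Complex.I_ne_zero hz0) (by simpa using hz.le)
    (by simpa using hw)

/-! ### Hopf's secant homotopy. -/

/-- The difference quotient of a curve with velocity `v`, extended to the diagonal. -/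
noncomputable def secant (v : ℝ → ℂ) (s t : ℝ) : ℂ := ∫ x in (0 : ℝ)..1, v (s + x * (t - s))

section Secant

variable {g v : ℝ → ℂ}

theorem continuous_secant (hv : Continuous v) : Continuous (Function.uncurry (secant v)) :=
  intervalIntegral.continuous_parametric_intervalIntegral_of_continuous'
    (f := fun (p : ℝ × ℝ) x => v (p.1 + x * (p.2 - p.1))) (by fun_prop) 0 1

theorem secant_self (s : ℝ) : secant v s s = v s := by simp [secant]

theorem sub_mul_secant (hv : Continuous v) (hg : ∀ t, HasDerivAt g (v t) t) (s t : ℝ) :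
    ((t - s : ℝ) : ℂ) * secant v s t = g t - g s := by
  have h : ∀ x ∈ uIcc (0 : ℝ) 1, HasDerivAt (fun x => g (s + x * (t - s)))
      ((t - s) • v (s + x * (t - s))) x := fun x _ =>
    (hg _).scomp x (by simpa using ((hasDerivAt_id x).mul_const (t - s)).const_add s)
  have := intervalIntegral.integral_eq_sub_of_hasDerivAt h
    ((by fun_prop : Continuous _).intervalIntegrable _ _)
  rw [intervalIntegral.integral_smul] at this
  simpa [secant] using this

/-- On the strip `0 ≤ t - s ≤ 2π`, a nonvanishing continuous function that is a positive multiple of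
the secant vector from `g s` to `g t` in the interior, where `g` is a closed curve with velocity
`v`. -/
noncomputable def loopSecant (v : ℝ → ℂ) (s t : ℝ) : ℂ := secant v s t - secant v s (t - 2 * Real.pi)

theorem continuous_loopSecant (hv : Continuous v) : Continuous (Function.uncurry (loopSecant v)) := by
  have h := continuous_secant hv
  exact h.sub (h.comp (by fun_prop : Continuous fun p : ℝ × ℝ => (p.1, p.2 - 2 * Real.pi)))

variable (hv : Continuous v) (hg : ∀ t, HasDerivAt g (v t) t)
  (hper : Function.Periodic g (2 * Real.pi))

include hg hper

theorem periodic_velocity : Function.Periodic v (2 * Real.pi) := fun t => by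
  have h := (hg (t + 2 * Real.pi)).comp_add_const t (2 * Real.pi)
  rw [show (fun x => g (x + 2 * Real.pi)) = g from funext hper] at h
  exact h.unique (hg t)

include hv

/-- The second secant spans a full period, over which the closed curve has zero increment, so only
the first one contributes. At the opposite edge of the strip the roles are exchanged, whence the
sign there. -/
theorem loopSecant_self (s : ℝ) : loopSecant v s s = v s := by
  have h := sub_mul_secant hv hg s (s - 2 * Real.pi)
  rw [hper.sub_eq, sub_self, mul_eq_zero] at h
  rw [loopSecant, secant_self, h.resolve_left (by simp), sub_zero]

theorem loopSecant_add_two_pi (s : ℝ) : loopSecant v s (s + 2 * Real.pi) = -v s := by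
  have h := sub_mul_secant hv hg s (s + 2 * Real.pi)
  rw [hper s, sub_self, mul_eq_zero] at h
  rw [loopSecant, add_sub_cancel_right, secant_self, h.resolve_left (by simp), zero_sub]

theorem loopSecant_eq {s t : ℝ} (h0 : 0 < t - s) (h1 : t - s < 2 * Real.pi) :
    ∃ x : ℝ, 0 < x ∧ loopSecant v s t = x * (g t - g s) := by
  have h2 : 0 < 2 * Real.pi - (t - s) := by linarith
  -- By periodicity both secants are multiples of `g t - g s`, with factors `1 / (t - s)` and `1 /
  -- (t - s - 2π)`. The second factor is negative and is subtracted.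
  refine ⟨1 / (t - s) + 1 / (2 * Real.pi - (t - s)), by positivity, ?_⟩
  have e1 := sub_mul_secant hv hg s t
  have e2 := sub_mul_secant hv hg s (t - 2 * Real.pi)
  rw [hper.sub_eq, ← e1] at e2
  rw [← e1, loopSecant]
  have n1 : ((t - s : ℝ) : ℂ) ≠ 0 := by exact_mod_cast h0.ne'
  have n2 : ((2 * Real.pi - (t - s) : ℝ) : ℂ) ≠ 0 := by exact_mod_cast h2.ne'
  push_cast at *
  field_simp
  linear_combination e2

variable (hne : ∀ t, v t ≠ 0) (hinj : ∀ s t, 0 < t - s → t - s < 2 * Real.pi → g t ≠ g s)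

include hne hinj

theorem loopSecant_ne_zero {s t : ℝ} (h0 : 0 ≤ t - s) (h1 : t - s ≤ 2 * Real.pi) :
    loopSecant v s t ≠ 0 := by
  rcases h0.eq_or_lt with h0 | h0
  · rw [show t = s by linarith, loopSecant_self hv hg hper]
    exact hne s
  rcases h1.eq_or_lt with h1 | h1
  · rw [show t = s + 2 * Real.pi by linarith, loopSecant_add_two_pi hv hg hper]
    exact neg_ne_zero.2 (hne s)
  obtain ⟨x, hx, h⟩ := loopSecant_eq hv hg hper h0 h1
  rw [h]
  exact mul_ne_zero (by exact_mod_cast hx.ne') (sub_ne_zero.2 (hinj s t h0 h1))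

/-- Hopf's theorem for a simple closed curve in the upper half plane touching the real axis at `0`
in the positive direction. -/
theorem winds_velocity_of_im_nonneg (hg0 : g 0 = 0) (him : ∀ t, 0 ≤ (g t).im)
    (hvi : (v 0).im = 0) (hvr : 0 < (v 0).re) : Winds v 1 := by
  have hpi := Real.pi_pos
  have hv0 : v 0 = ((v 0).re : ℝ) := Complex.ext rfl (by simpa using hvi)
  have hvper : v (2 * Real.pi) = v 0 := by
    simpa using periodic_velocity hg hper 0
  have hE := continuous_loopSecant hv
  -- The path runs along the legs of the triangle `0 ≤ s ≤ t ≤ 2π`, from `(0, 0)` via `(0, 2π)` to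
  -- `(2π, 2π)`. On the first leg the chord starts at the lowest point and lies in the closed upper
  -- half plane, like `exp (iτ)` for `τ ≤ π`; on the second leg both lie in the lower one. At the
  -- three corners both are real with the same sign.
  have hstart : Winds (fun τ => loopSecant v (max 0 (2 * τ - 2 * Real.pi)) (min (2 * Real.pi) (2 * τ)))
      1 := by
    refine Winds.exp_mul_I.of_div_mem_slitPlane (hE.comp (by fun_prop :
      Continuous fun τ : ℝ => (max 0 (2 * τ - 2 * Real.pi), min (2 * Real.pi) (2 * τ)))).continuousOn
      ?_ fun τ hτ => ?_
    · simp only [mul_zero, zero_sub]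
      rw [max_eq_left (by linarith), min_eq_right (by linarith), max_eq_right (by linarith),
        min_eq_left (by linarith), show 2 * (2 * Real.pi) - 2 * Real.pi = 2 * Real.pi by ring,
        loopSecant_self hv hg hper, loopSecant_self hv hg hper, hvper]
    have hexp : (Complex.exp (τ * Complex.I)).im = Real.sin τ := Complex.exp_ofReal_mul_I_im τ
    rcases le_total τ Real.pi with h | h
    · rw [max_eq_left (by linarith), min_eq_right (by linarith)]
      rcases hτ.1.eq_or_lt with h0 | h0
      · rw [← h0, mul_zero, loopSecant_self hv hg hper, hv0]
        simpa using hvr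
      rcases h.eq_or_lt with h1 | h1
      · have := loopSecant_add_two_pi hv hg hper 0
        rw [zero_add] at this
        rw [h1, this, hv0, Complex.exp_pi_mul_I, neg_div_neg_eq]
        simpa using hvr
      obtain ⟨x, hx, he⟩ := loopSecant_eq hv hg hper (s := 0) (t := 2 * τ) (by linarith)
        (by linarith)
      refine Complex.div_mem_slitPlane_of_im (loopSecant_ne_zero hv hg hper hne hinj (by linarith)
        (by linarith)) ?_ ?_
      · rw [he, hg0, sub_zero]
        simpa using mul_nonneg hx.le (him (2 * τ))
      · rw [hexp]
        exact Real.sin_pos_of_pos_of_lt_pi h0 h1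
    · rw [max_eq_right (by linarith), min_eq_left (by linarith)]
      rcases hτ.2.eq_or_lt with h0 | h0
      · rw [h0, show 2 * (2 * Real.pi) - 2 * Real.pi = 2 * Real.pi by ring,
          loopSecant_self hv hg hper, hvper, hv0]
        push_cast
        rw [Complex.exp_two_pi_mul_I]
        simpa using hvr
      rcases h.eq_or_lt with h1 | h1
      · have := loopSecant_add_two_pi hv hg hper 0
        rw [zero_add] at this
        rw [← h1, sub_self, this, hv0, Complex.exp_pi_mul_I, neg_div_neg_eq]
        simpa using hvr
      obtain ⟨x, hx, he⟩ := loopSecant_eq hv hg hper (s := 2 * τ - 2 * Real.pi)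
        (t := 2 * Real.pi) (by linarith) (by linarith)
      rw [← neg_div_neg_eq]
      refine Complex.div_mem_slitPlane_of_im (neg_ne_zero.2
        (loopSecant_ne_zero hv hg hper hne hinj (by linarith) (by linarith))) ?_ ?_
      · have hg2 : g (2 * Real.pi) = 0 := by simpa [hg0] using hper 0
        rw [he, hg2]
        simpa using mul_nonneg hx.le (him (2 * τ - 2 * Real.pi))
      · rw [Complex.neg_im, hexp, neg_pos, ← Real.sin_sub_two_pi]
        exact Real.sin_neg_of_neg_of_neg_pi_lt (by linarith) (by linarith)
  -- Deform the two legs linearly into the diagonal, where `loopSecant` is the velocity. The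
  -- deformation stays in the strip `0 ≤ t - s ≤ 2π`, so no zero occurs.
  have := Winds.homotopy (n := 1) (H := fun l τ => loopSecant v
      (l * τ + (1 - l) * max 0 (2 * τ - 2 * Real.pi)) (l * τ + (1 - l) * min (2 * Real.pi) (2 * τ)))
    (hE.comp (by fun_prop : Continuous fun p : ℝ × ℝ =>
      (p.1 * p.2 + (1 - p.1) * max 0 (2 * p.2 - 2 * Real.pi),
       p.1 * p.2 + (1 - p.1) * min (2 * Real.pi) (2 * p.2)))).continuousOn ?_ ?_ (by simpa using hstart)
  · simpa [loopSecant_self hv hg hper] using this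
  · intro l hl τ hτ
    have a1 : 0 ≤ l * τ := mul_nonneg hl.1 hτ.1
    have a2 : 0 ≤ l * (2 * Real.pi - τ) := mul_nonneg hl.1 (by linarith [hτ.2])
    have hl' : 0 ≤ 1 - l := by linarith [hl.2]
    have b1 : max 0 (2 * τ - 2 * Real.pi) ≤ min (2 * Real.pi) (2 * τ) :=
      max_le (le_min (by linarith) (by linarith [hτ.1]))
        (le_min (by linarith [hτ.2]) (by linarith))
    have b2 : min (2 * Real.pi) (2 * τ) - max 0 (2 * τ - 2 * Real.pi) ≤ 2 * Real.pi := by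
      linarith [min_le_left (2 * Real.pi) (2 * τ), le_max_left 0 (2 * τ - 2 * Real.pi)]
    apply loopSecant_ne_zero hv hg hper hne hinj
    · linarith [mul_nonneg hl' (sub_nonneg.2 b1)]
    · nlinarith [mul_le_mul_of_nonneg_left b2 hl', hl.1]
  · intro l _
    simp only [mul_zero, zero_sub, zero_add]
    rw [max_eq_left (by linarith), min_eq_right (by linarith), max_eq_right (by linarith),
      min_eq_left (by linarith), show 2 * (2 * Real.pi) - 2 * Real.pi = 2 * Real.pi by ring,
      ← add_mul, add_sub_cancel, one_mul, mul_zero, loopSecant_self hv hg hper,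
      loopSecant_self hv hg hper, hvper]

end Secant

/-! ### Winding around a point near the lowest one, and Hopf's theorem. -/

theorem Real.cos_le_cos_of_mem_Icc {η t : ℝ} (hη : 0 ≤ η) (ht : t ∈ Icc η (2 * Real.pi - η)) :
    Real.cos t ≤ Real.cos η := by
  rcases le_total t Real.pi with h | h
  · exact Real.cos_le_cos_of_nonneg_of_le_pi hη h ht.1
  · rw [← Real.cos_two_pi_sub t]
    exact Real.cos_le_cos_of_nonneg_of_le_pi hη (by linarith) (by linarith [ht.2])

/-- A closed curve in the upper half plane that touches the real axis only at `0`, in the positive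
direction, winds once around the points slightly above `0`. -/
theorem winds_sub_of_im_nonneg {g : ℝ → ℂ} {w : ℂ} (hg : Continuous g)
    (hper : Function.Periodic g (2 * Real.pi)) (hne : ∀ t, 0 < t → t < 2 * Real.pi → g t ≠ 0)
    (hg0 : g 0 = 0) (him : ∀ t, 0 ≤ (g t).im) (hd : HasDerivAt g w 0) (hw : 0 < w.re) :
    ∃ δ : ℝ, Winds (fun t => g t - δ * Complex.I) 1 := by
  have hpi := Real.pi_pos
  have hg2 : g (2 * Real.pi) = 0 := by simpa [hg0] using hper 0
  -- Near the contact point the curve moves to the right, so the sign of its real part is known just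
  -- after and just before the contact.
  obtain ⟨η, hη0, hηpi, hηpos, hηneg⟩ : ∃ η : ℝ, 0 < η ∧ η ≤ Real.pi / 2 ∧
      (∀ t, 0 < t → t < η → 0 < (g t).re) ∧
      ∀ t, 2 * Real.pi - η < t → t < 2 * Real.pi → (g t).re < 0 := by
    have hre : HasDerivAt (fun t => (g t).re) w.re 0 := 
      Complex.reCLM.hasFDerivAt.comp_hasDerivAt (0 : ℝ) hd
    have h := (hasDerivAt_iff_tendsto_slope.1 hre).eventually (lt_mem_nhds hw)
    rw [eventually_nhdsWithin_iff, Metric.eventually_nhds_iff] at h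
    obtain ⟨ε, hε, h⟩ := h
    have key : ∀ t, |t| < ε → t ≠ 0 → 0 < t⁻¹ * (g t).re := fun t ht ht0 => by
      simpa [slope_def_field, hg0, div_eq_inv_mul] using h (by simpa using ht) ht0
    refine ⟨min ε (Real.pi / 2), lt_min hε (by positivity), min_le_right _ _, fun t h0 h1 => ?_,
      fun t h0 h1 => ?_⟩
    · have := key t (by rw [abs_of_pos h0]; exact h1.trans_le (min_le_left _ _)) h0.ne'
      exact pos_of_mul_pos_right this (inv_pos.2 h0).le
    · have := key (t - 2 * Real.pi)
        (by rw [abs_of_neg (by linarith)]; linarith [min_le_left ε (Real.pi / 2)]) (by linarith)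
      rw [hper.sub_eq] at this
      have h3 : (t - 2 * Real.pi)⁻¹ < 0 := inv_lt_zero.2 (by linarith)
      exact neg_of_mul_pos_right this h3.le
  obtain ⟨t₀, ht₀, hmin⟩ := (isCompact_Icc (a := η) (b := 2 * Real.pi - η)).exists_isMinOn
    (nonempty_Icc.2 (by linarith)) hg.norm.continuousOn
  have hm : 0 < ‖g t₀‖ := norm_pos_iff.2 (hne _ (by linarith [ht₀.1]) (by linarith [ht₀.2]))
  set δ : ℝ := ‖g t₀‖ / 2 with hδ
  have hδ0 : 0 < δ := by positivity
  have hc1 : Real.cos η < 1 := by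
    simpa using Real.cos_lt_cos_of_nonneg_of_le_pi_div_two le_rfl hηpi hη0
  have hc2 : Real.cos η < Real.cos (η / 2) :=
    Real.cos_lt_cos_of_nonneg_of_le_pi_div_two (by linarith) hηpi (by linarith)
  have hc3 : Real.cos (η / 2) < 1 := by
    simpa using Real.cos_lt_cos_of_nonneg_of_le_pi_div_two le_rfl (by linarith)
      (by linarith : 0 < η / 2)
  have hc4 : 0 < Real.cos (η / 2) := Real.cos_pos_of_mem_Ioo ⟨by linarith, by linarith⟩
  -- A bump equal to `1` at the contact parameter and vanishing on `[η, 2π - η]`. Subtracting `δ i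
  -- ψ` pushes the curve below `0` only near the contact.
  set ψ : ℝ → ℝ := fun t => max 0 ((Real.cos t - Real.cos η) / (1 - Real.cos η)) with hψ
  have hψc : Continuous ψ := by fun_prop
  have hψ0 : ∀ t, 0 ≤ ψ t := fun t => le_max_left _ _
  have hψ1 : ∀ t, ψ t ≤ 1 := fun t => max_le zero_le_one
    ((div_le_one (by linarith)).2 (by linarith [Real.cos_le_one t]))
  have hψz : ψ 0 = 1 := by
    simp only [hψ, Real.cos_zero]
    rw [div_self (by linarith)]
    simp
  have hψp : ψ (2 * Real.pi) = 1 := by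
    rw [← hψz]
    simp [hψ]
  have hψη : ∀ t ∈ Icc η (2 * Real.pi - η), ψ t = 0 := fun t ht =>
    max_eq_left (div_nonpos_of_nonpos_of_nonneg
      (by linarith [Real.cos_le_cos_of_mem_Icc hη0.le ht]) (by linarith))
  have hcases : ∀ t ∈ Icc 0 (2 * Real.pi), t = 0 ∨ t = 2 * Real.pi ∨ (0 < t ∧ t < η) ∨
      t ∈ Icc η (2 * Real.pi - η) ∨ (2 * Real.pi - η < t ∧ t < 2 * Real.pi) := by
    intro t ht
    rcases ht.1.eq_or_lt with h | h
    · exact Or.inl h.symm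
    rcases ht.2.eq_or_lt with h' | h'
    · exact Or.inr (Or.inl h')
    rcases lt_or_ge t η with h1 | h1
    · exact Or.inr (Or.inr (Or.inl ⟨h, h1⟩))
    rcases le_or_gt t (2 * Real.pi - η) with h2 | h2
    · exact Or.inr (Or.inr (Or.inr (Or.inl ⟨h1, h2⟩)))
    · exact Or.inr (Or.inr (Or.inr (Or.inr ⟨h2, h'⟩)))
  -- The comparison loop is a rotated unit circle with `0` in its inside. Its imaginary part `cos
  -- (η/2) - cos t` changes sign at `η/2`, so it is positive on all of `[η, 2π - η]`, where
  -- imaginary parts are compared; on the two short arcs real parts are compared.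
  have hk : Winds (fun t => -Complex.I * (Complex.exp (t * Complex.I) - Real.cos (η / 2))) 1 := by
    refine Winds.const_mul (by simp) (Winds.exp_mul_I.of_div_mem_slitPlane (by fun_prop) ?_ ?_)
    · push_cast
      rw [Complex.exp_two_pi_mul_I]
      simp
    · intro t _
      rw [sub_div, div_self (Complex.exp_ne_zero _), sub_eq_add_neg]
      refine Complex.mem_slitPlane_of_norm_lt_one ?_
      rw [norm_neg, norm_div, Complex.norm_exp_ofReal_mul_I, Complex.norm_real, div_one,
        Real.norm_of_nonneg hc4.le]
      exact hc3
  have hkre : ∀ t : ℝ, (-Complex.I * (Complex.exp (t * Complex.I) - Real.cos (η / 2))).re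
      = Real.sin t := fun t => by
    rw [Complex.mul_re]
    simp [Complex.exp_ofReal_mul_I_im, -Complex.ofReal_cos]
  have hkim : ∀ t : ℝ, (-Complex.I * (Complex.exp (t * Complex.I) - Real.cos (η / 2))).im
      = Real.cos (η / 2) - Real.cos t := fun t => by
    rw [Complex.mul_im]
    simp [Complex.exp_ofReal_mul_I_re, -Complex.ofReal_cos]
  have hk0 : (-(δ * Complex.I)) / (-Complex.I * (1 - Real.cos (η / 2))) ∈ Complex.slitPlane := by
    have : (-(δ * Complex.I)) / (-Complex.I * (1 - Real.cos (η / 2))) =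
        ((δ / (1 - Real.cos (η / 2)) : ℝ) : ℂ) := by
      rw [show -(δ * Complex.I) = -Complex.I * δ by ring, mul_div_mul_left _ _ (by simp)]
      push_cast
      rfl
    rw [this, Complex.ofReal_mem_slitPlane]
    exact div_pos hδ0 (by linarith)
  have hstart : Winds (fun t => g t - δ * Complex.I * ψ t) 1 := by
    refine hk.of_div_mem_slitPlane (by fun_prop) (by simp [hψz, hψp, hg0, hg2]) fun t ht => ?_
    rcases hcases t ht with rfl | rfl | ⟨h0, h1⟩ | h | ⟨h0, h1⟩
    · simpa [hψz, hg0] using hk0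
    · simpa [hψp, hg2] using hk0
    · refine Complex.div_mem_slitPlane_of_re ?_ ?_
      · simpa using hηpos t h0 h1
      · rw [hkre]
        exact Real.sin_pos_of_pos_of_lt_pi h0 (by linarith)
    · rw [hψη t h]
      refine Complex.div_mem_slitPlane_of_im ?_ ?_ ?_
      · simpa using hne t (by linarith [h.1]) (by linarith [h.2])
      · simpa using him t
      · rw [hkim]
        linarith [Real.cos_le_cos_of_mem_Icc hη0.le h]
    · rw [← neg_div_neg_eq]
      refine Complex.div_mem_slitPlane_of_re ?_ ?_
      · simpa using hηneg t h0 h1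
      · rw [Complex.neg_re, hkre, neg_pos, ← Real.sin_sub_two_pi]
        exact Real.sin_neg_of_neg_of_neg_pi_lt (by linarith) (by linarith)
  refine ⟨δ, ?_⟩
  have := Winds.homotopy (n := 1)
    (H := fun s t => g t - δ * Complex.I * ((1 - s) * ψ t + s : ℝ)) ?_ ?_ ?_ (by simpa using hstart)
  · simpa using this
  · exact Continuous.continuousOn (by simp only [Function.uncurry_def]; fun_prop)
  · intro s hs t ht hzero
    rcases hcases t ht with rfl | rfl | ⟨h0, h1⟩ | h | ⟨h0, h1⟩
    · simp [hψz, hg0, hδ0.ne'] at hzero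
    · simp [hψp, hg2, hδ0.ne'] at hzero
    · have := congrArg Complex.re hzero
      simp at this
      linarith [hηpos t h0 h1]
    · rw [sub_eq_zero] at hzero
      have h1 : ‖g t₀‖ ≤ ‖g t‖ := hmin h
      rw [hzero, norm_mul, norm_mul, Complex.norm_I, Complex.norm_real, Complex.norm_real,
        Real.norm_of_nonneg hδ0.le, hψη t h, mul_zero, zero_add, Real.norm_of_nonneg hs.1] at h1
      nlinarith [hs.2]
    · have := congrArg Complex.re hzero
      simp at this
      linarith [hηneg t h0 h1]
  · intro s _
    simp [hψz, hψp, hg0, hg2]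

/-- At a lowest point the velocity is horizontal, and its direction decides whether both winding
numbers are `1` or `-1`. The orientation is not known yet, so only their equality and `n ≠ 0` are
recorded. -/
theorem exists_winds_of_im_nonneg {g v : ℝ → ℂ} (hv : Continuous v)
    (hg : ∀ t, HasDerivAt g (v t) t) (hper : Function.Periodic g (2 * Real.pi))
    (hne : ∀ t, v t ≠ 0) (hinj : ∀ s t, 0 < t - s → t - s < 2 * Real.pi → g t ≠ g s)
    (hg0 : g 0 = 0) (him : ∀ t, 0 ≤ (g t).im) :
    ∃ n : ℤ, n ≠ 0 ∧ ∃ q, Winds v n ∧ Winds (fun t => g t - q) n := by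
  have hvi : (v 0).im = 0 := by
    have hmin : IsLocalMin (fun t => (g t).im) 0 :=
      Eventually.of_forall fun t => by simpa [hg0] using him t
    exact hmin.hasDerivAt_eq_zero (Complex.imCLM.hasFDerivAt.comp_hasDerivAt (0 : ℝ) (hg 0))
  have hcont : Continuous g := continuous_iff_continuousAt.2 fun t => (hg t).continuousAt
  have hne' : ∀ t, 0 < t → t < 2 * Real.pi → g t ≠ 0 := fun t h0 h1 =>
    hg0 ▸ hinj 0 t (by simpa using h0) (by simpa using h1)
  have hvr : (v 0).re ≠ 0 := fun h => hne 0 (Complex.ext h hvi)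
  rcases lt_or_gt_of_ne hvr with h | h
  -- The reflection `z ↦ -z̄` preserves the upper half plane, reverses the horizontal direction and
  -- negates winding numbers.
  · have hg' : ∀ t, HasDerivAt (fun t => -(starRingEnd ℂ) (g t)) (-(starRingEnd ℂ) (v t)) t :=
      fun t => (Complex.conjCLE.toContinuousLinearMap.hasFDerivAt.comp_hasDerivAt t (hg t)).neg
    have hper' : Function.Periodic (fun t => -(starRingEnd ℂ) (g t)) (2 * Real.pi) := fun t => by
      simp only [hper t]
    have hinj' : ∀ s t, 0 < t - s → t - s < 2 * Real.pi →
        -(starRingEnd ℂ) (g t) ≠ -(starRingEnd ℂ) (g s) := fun s t h0 h1 h =>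
      hinj s t h0 h1 ((starRingEnd ℂ).injective (neg_injective h))
    have w1 := winds_velocity_of_im_nonneg (by fun_prop) hg' hper' (fun t => by simpa using hne t)
      hinj' (by simp [hg0]) (fun t => by simpa using him t) (by simpa using hvi) (by simpa using h)
    obtain ⟨δ, w2⟩ := winds_sub_of_im_nonneg (by fun_prop) hper'
      (fun t h0 h1 => by simpa using hne' t h0 h1) (by simp [hg0]) (fun t => by simpa using him t)
      (hg' 0) (by simpa using h)
    refine ⟨-1, by simp, δ * Complex.I, ?_, ?_⟩
    · exact (w1.conj.const_mul (z := -1) (by simp)).congr fun t _ => by simp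
    · exact (w2.conj.const_mul (z := -1) (by simp)).congr fun t _ => by simp; ring
  · obtain ⟨δ, w⟩ := winds_sub_of_im_nonneg hcont hper hne' hg0 him (hg 0) h
    exact ⟨1, by simp, δ * Complex.I,
      winds_velocity_of_im_nonneg hv hg hper hne hinj hg0 him hvi h, w⟩

/-- Hopf's theorem: the velocity of a simple closed curve winds around the origin as often as the
curve itself winds around suitable points, and this number is not zero. -/
theorem exists_winds_velocity_and_sub {g v : ℝ → ℂ} (hv : Continuous v)
    (hg : ∀ t, HasDerivAt g (v t) t) (hper : Function.Periodic g (2 * Real.pi))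
    (hne : ∀ t, v t ≠ 0) (hinj : ∀ s t, 0 < t - s → t - s < 2 * Real.pi → g t ≠ g s) :
    ∃ n : ℤ, n ≠ 0 ∧ ∃ q, Winds v n ∧ Winds (fun t => g t - q) n := by
  have hcont : Continuous g := continuous_iff_continuousAt.2 fun t => (hg t).continuousAt
  obtain ⟨a, -, hmin⟩ := (isCompact_Icc (a := 0) (b := 2 * Real.pi)).exists_isMinOn
    ⟨0, Winds.zero_mem⟩ (Complex.continuous_im.comp hcont).continuousOn
  have hmin' : ∀ t, (g a).im ≤ (g t).im := fun t => by
    obtain ⟨y, hy, hfy⟩ := hper.exists_mem_Ico₀ Real.two_pi_pos t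
    rw [hfy]
    exact hmin (Ico_subset_Icc_self hy)
  obtain ⟨n, hn, q, h1, h2⟩ := exists_winds_of_im_nonneg (g := fun t => g (a + t) - g a)
    (v := fun t => v (a + t)) (by fun_prop) (fun t => ((hg (a + t)).comp_const_add a t).sub_const _)
    (fun t => by simp only [← add_assoc, hper (a + t)]) (fun t => hne _)
    (fun s t h0 h1 => by simpa using hinj (a + s) (a + t) (by simpa using h0) (by simpa using h1))
    (by simp) (fun t => by simpa using hmin' (a + t))
  refine ⟨n, hn, g a + q, h1.of_shift hv (periodic_velocity hg hper), ?_⟩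
  refine Winds.of_shift (a := a) (by fun_prop) (fun t => by simp only [hper t]) ?_
  simpa only [sub_add_eq_sub_sub] using h2

/-! ### Transfer to the Euclidean plane; closed disks. -/

/-- The plane as the complex numbers. -/
noncomputable def planeToComplex : Plane ≃ₗᵢ[ℝ] ℂ := Complex.orthonormalBasisOneI.repr.symm

theorem planeToComplex_cos_sin (θ : ℝ) :
    planeToComplex !₂[Real.cos θ, Real.sin θ] = Complex.exp (θ * Complex.I) := by
  rw [Complex.exp_mul_I]
  simp [planeToComplex]

theorem curveLift_periodic (c : Circle → Plane) :
    Function.Periodic (curveLift c) (2 * Real.pi) := fun s => by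
  simp [curveLift, Circle.periodic_exp s]

theorem HasWindingNumber.of_winds {c : Circle → Plane} {p : Plane} {n : ℤ}
    (h : Winds (fun t => planeToComplex (curveLift c t - p)) n) : HasWindingNumber c p n := by
  refine ⟨fun z hz => ?_, ?_⟩
  · refine h.ne_zero_of_periodic (fun t => by simp only [curveLift_periodic c t])
      (Complex.arg z) ?_
    simp [curveLift, hz]
  · obtain ⟨L, hL, hf, hn⟩ := h
    refine ⟨fun t => (L t).im, ⟨Complex.continuous_im.comp_continuousOn hL, fun t ht => ?_⟩, ?_⟩
    · have hft : planeToComplex (curveLift c t - p) = Complex.exp (L t) := (hf t ht).symm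
      apply planeToComplex.injective
      rw [map_smul, planeToComplex_cos_sin, ← planeToComplex.norm_map, hft,
        Complex.norm_exp, Complex.real_smul, Complex.ofReal_exp, ← Complex.exp_add,
        Complex.re_add_im]
    · have := congrArg Complex.im hn
      simp at this
      linarith

namespace IsClosedTopologicalDisk

variable {Δ : Set Plane}

theorem isCompact (h : IsClosedTopologicalDisk Δ) : IsCompact Δ := by
  obtain ⟨e⟩ := h
  have := isCompact_iff_compactSpace.1 (isCompact_closedBall (0 : Plane) 1)
  exact isCompact_iff_compactSpace.2 e.symm.compactSpace

/-- A closed topological disk is contractible to each of its points. -/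
theorem exists_contraction (h : IsClosedTopologicalDisk Δ) (p : Δ) :
    ∃ K : ℝ → Δ → Δ, Continuous (Function.uncurry K) ∧ (∀ x, K 0 x = p) ∧ ∀ x, K 1 x = x := by
  obtain ⟨e⟩ := h
  -- The straight-line contraction of the ball, transported by `e`. Clamping `s` to `[0, 1]` makes
  -- it defined and continuous for all real `s`.
  refine ⟨fun s x => e.symm ⟨AffineMap.lineMap (e p : Plane) (e x : Plane)
    (projIcc (0 : ℝ) 1 zero_le_one s : ℝ), ?_⟩, ?_, fun x => ?_, fun x => ?_⟩
  · exact (convex_closedBall (0 : Plane) 1).lineMap_mem (e p).2 (e x).2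
      (projIcc (0 : ℝ) 1 zero_le_one s).2
  · refine e.symm.continuous.comp (Continuous.subtype_mk ?_ _)
    simp only [AffineMap.lineMap_apply_module]
    have : Continuous (projIcc (0 : ℝ) 1 zero_le_one) := continuous_projIcc
    fun_prop
  · simp
  · simp

end IsClosedTopologicalDisk

theorem curveLift_ne_of_injective {c : Circle → Plane} (hinj : Function.Injective c) (s t : ℝ)
    (h0 : 0 < t - s) (h1 : t - s < 2 * Real.pi) : curveLift c t ≠ curveLift c s := fun h => by
  obtain ⟨m, hm⟩ := Circle.exp_eq_exp.1 (hinj h)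
  have hpi := Real.two_pi_pos
  have e : t - s = m * (2 * Real.pi) := by linarith
  rw [e] at h0 h1
  have a : (0 : ℝ) < m := pos_of_mul_pos_left h0 hpi.le
  have b : (m : ℝ) < 1 := by nlinarith
  norm_cast at a b
  omega

/-! ### Rotation numbers of the boundary curve and of its image. -/

/-- The rotation number of a positively oriented boundary curve of a disk is one. -/
theorem winds_deriv_of_isPositivelyOriented {c : Circle → Plane}
    (hc : IsRegularClosedCurve 1 c) (hinj : Function.Injective c) {Δ : Set Plane}
    (hΔ : IsClosedTopologicalDisk Δ) (hbd : frontier Δ = Set.range c)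
    (hpos : IsPositivelyOriented c Δ) :
    Winds (fun t => planeToComplex (deriv (curveLift c) t)) 1 := by
  have hd : ∀ t, HasDerivAt (curveLift c) (deriv (curveLift c) t) t := fun t =>
    (hc.1.differentiable (by simp) t).hasDerivAt
  have hdc : Continuous (deriv (curveLift c)) := hc.1.continuous_deriv (by simp)
  have hmem : ∀ z, c z ∈ Δ := fun z =>
    hΔ.isCompact.isClosed.frontier_subset (hbd ▸ mem_range_self z)
  obtain ⟨n, hn, q, hw, hq⟩ := exists_winds_velocity_and_sub
    (g := fun t => planeToComplex (curveLift c t))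
    (v := fun t => planeToComplex (deriv (curveLift c) t))
    (planeToComplex.continuous.comp hdc)
    (fun t => planeToComplex.toContinuousLinearEquiv.toContinuousLinearMap.hasFDerivAt.comp_hasDerivAt
      t (hd t))
    (fun t => by simp only [curveLift_periodic c t])
    (fun t => by simpa using hc.2 t)
    (fun s t h0 h1 => by simpa using curveLift_ne_of_injective hinj s t h0 h1)
  obtain ⟨q, rfl⟩ := planeToComplex.surjective q
  simp only [← map_sub] at hq
  have hwn := HasWindingNumber.of_winds hq
  -- If `q` were outside `Δ`, contracting `Δ` would shrink the curve to a point without meeting `q`,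
  -- forcing `n = 0`.
  have hqΔ : q ∈ Δ := by
    by_contra hqΔ
    obtain ⟨K, hK, hK0, hK1⟩ := hΔ.exists_contraction ⟨c 1, hmem 1⟩
    refine hn (hwn.unique (HasWindingNumber.of_winds ?_))
    have := Winds.homotopy (n := 0) (H := fun s t => planeToComplex (K s ⟨curveLift c t, hmem _⟩ - q))
      ?_ ?_ ?_ ?_
    · simpa [hK1] using this
    · have h1 : Continuous fun p : ℝ × ℝ => (⟨curveLift c p.2, hmem _⟩ : Δ) :=
        Continuous.subtype_mk (hc.1.continuous.comp continuous_snd) _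
      have h2 := hK.comp (continuous_fst.prodMk h1)
      exact (planeToComplex.continuous.comp
        ((continuous_subtype_val.comp h2).sub continuous_const)).continuousOn
    · intro s _ t _ h
      rw [map_eq_zero_iff _ planeToComplex.injective, sub_eq_zero] at h
      exact hqΔ (h ▸ Subtype.coe_prop _)
    · intro s _
      simp only [← curveLift_periodic c 0, zero_add]
    · simp only [hK0]
      refine Winds.const ?_
      rw [map_ne_zero_iff _ planeToComplex.injective, sub_ne_zero]
      exact fun h => hqΔ (h ▸ hmem 1)
  -- The curve fills the frontier of `Δ` and avoids `q`, as it has a winding number there.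
  have hqi : q ∈ interior Δ := by
    by_contra hqi
    obtain ⟨z, hz⟩ : q ∈ range c := hbd ▸ ⟨subset_closure hqΔ, hqi⟩
    exact hwn.1 z hz
  rwa [hwn.unique (hpos q hqi)] at hw

theorem ContinuousLinearMap.apply_ne_zero_of_det_ne_zero {A : Plane →L[ℝ] Plane} (hA : A.det ≠ 0)
    {v : Plane} (hv : v ≠ 0) : A v ≠ 0 := by
  have := (LinearMap.equivOfDetNeZero (A : Plane →ₗ[ℝ] Plane) hA).map_ne_zero_iff.2 hv
  exact this

theorem mainTheorem1 (F : Plane → Plane) (hF : IsExcellent F)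
    (r : ℕ∞) (hr : 1 ≤ r)
    (c : Circle → Plane) (hc : IsRegularClosedCurve r c) (hinj : Function.Injective c)
    (Δ : Set Plane) (hΔ : IsClosedTopologicalDisk Δ) (hbd : frontier Δ = Set.range c)
    (hpos : IsPositivelyOriented c Δ)
    (hcrit : Δ ∩ criticalSet F = ∅) :
    IsRegularClosedCurve r (F ∘ c) ∧
      ∀ p ∈ Δ, HasRotationNumber (F ∘ c)
        ((SignType.sign (fderiv ℝ F p).det : SignType) : ℤ) := by
  have hc1 : IsRegularClosedCurve 1 c := ⟨hc.1.of_le (by exact_mod_cast hr), hc.2⟩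
  have hmem : ∀ z, c z ∈ Δ := fun z =>
    hΔ.isCompact.isClosed.frontier_subset (hbd ▸ mem_range_self z)
  have hdet : ∀ x ∈ Δ, (fderiv ℝ F x).det ≠ 0 := fun x hx h =>
    (hcrit ▸ (⟨hx, h⟩ : x ∈ Δ ∩ criticalSet F) : x ∈ (∅ : Set Plane))
  have hdc : Continuous (deriv (curveLift c)) := hc1.1.continuous_deriv (by simp)
  have hlift : curveLift (F ∘ c) = F ∘ curveLift c := rfl
  have hderiv : ∀ t, deriv (curveLift (F ∘ c)) t =
      fderiv ℝ F (curveLift c t) (deriv (curveLift c) t) := fun t =>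
    ((hF.1.differentiable (by simp) _).hasFDerivAt.comp_hasDerivAt t
      (hc1.1.differentiable (by simp) t).hasDerivAt).deriv
  refine ⟨⟨?_, fun t => ?_⟩, fun p hp => HasWindingNumber.of_winds ?_⟩
  · rw [hlift]
    exact (hF.1.of_le (by exact_mod_cast le_top)).comp hc.1
  · rw [hderiv]
    exact ContinuousLinearMap.apply_ne_zero_of_det_ne_zero (hdet _ (hmem _)) (hc.2 t)
  · obtain ⟨K, hK, hK0, hK1⟩ := hΔ.exists_contraction ⟨p, hp⟩
    have hw := winds_deriv_of_isPositivelyOriented hc1 hinj hΔ hbd hpos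
    -- Conjugating `DF p` by the identification of the plane with `ℂ` does not change its
    -- determinant.
    have hA : LinearMap.det ((planeToComplex.toLinearEquiv : Plane →ₗ[ℝ] ℂ) ∘ₗ
        (fderiv ℝ F p : Plane →ₗ[ℝ] Plane) ∘ₗ (planeToComplex.toLinearEquiv.symm : ℂ →ₗ[ℝ] Plane))
        = (fderiv ℝ F p).det := LinearMap.det_conj _ _
    have hstart := hw.linearMap _ (hA ▸ hdet p hp)
    rw [hA, mul_one] at hstart
    -- Only the point at which `DF` is taken moves, from `p` to `c t` inside `Δ`; the vector `c' t`
    -- stays fixed. Invertibility of `DF` on `Δ` keeps the image nonzero.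
    have := Winds.homotopy (H := fun s t => planeToComplex
      (fderiv ℝ F (K s ⟨curveLift c t, hmem _⟩) (deriv (curveLift c) t))) ?_ ?_ ?_
      (hstart.congr fun t _ => by simp [hK0])
    · refine this.congr fun t _ => ?_
      rw [sub_zero, hK1, ← hderiv, curveLift, velocity_exp]
    · have h1 : Continuous fun p : ℝ × ℝ => (⟨curveLift c p.2, hmem _⟩ : Δ) :=
        Continuous.subtype_mk (hc.1.continuous.comp continuous_snd) _
      have h2 := continuous_subtype_val.comp (hK.comp (continuous_fst.prodMk h1))
      exact (planeToComplex.continuous.comp (((hF.1.continuous_fderiv (by simp)).comp h2).clm_apply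
        (hdc.comp continuous_snd))).continuousOn
    · intro s _ t _
      rw [map_ne_zero_iff _ planeToComplex.injective]
      exact ContinuousLinearMap.apply_ne_zero_of_det_ne_zero (hdet _ (Subtype.coe_prop _)) (hc.2 t)
    · intro s _
      have h1 : deriv (curveLift c) (2 * Real.pi) = deriv (curveLift c) 0 := by
        rw [← velocity_exp, ← velocity_exp]
        simp
      have h2 : curveLift c (2 * Real.pi) = curveLift c 0 := by simp [curveLift]
      simp only [h1, h2]
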